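/- All graphs are finite and simple. For a vertex $v$ of a graph $G$ let $N(v)$ be the set of neighbours of $v$, and for $S\subseteq V(G)$ let $N(S)=\bigcup_{v\in S}N(v)$. A set $S\subseteq V(G)$ is a total dominating set (TD-set) if every vertex of $G$ has a neighbour in $S$; $\Gamma_t(G)$ is the maximum cardinality of an inclusion-minimal TD-set. A set $S$ is open-open irredundant if $N(v)\setminus N(S\setminus\{v\})\neq\emptyset$ for every $v\in S$; $\mathrm{OOIR}(G)$ is the maximum cardinality of such a set. The indicated total domination game on a graph $G$ without isolated vertices is played as follows, starting with $D=\emptyset$: in each round Dominator indicates a vertex $v$ that has no neighbour in $D$, and Staller chooses a neighbour of $v$ not yet in $D$ and adds it to $D$. The game ends when $D$ is a TD-set. Dominator wants to minimize the final size $|D|$ and Staller wants to maximize it; $\gamma_t^i(G)$ is the final size of $D$ under optimal play. Let $H=P_4\oplus P_4$ be the join of two disjoint paths $u_1v_1w_1x_1$ and $u_2v_2w_2x_2$ of order $4$ (all edges between the two paths are added). For $k\ge 1$ let $H_1,\dots,H_k$ be disjoint copies of $H$, where $u_{i,j},v_{i,j},w_{i,j},x_{i,j}$ denote the vertices of $H_i$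 corresponding to $u_j,v_j,w_j,x_j$. Let $G_1=H_1$, and for $k\ge 2$ let $G_k$ be obtained from the disjoint union of $H_1,\dots,H_k$ by adding the edges $w_{i,2}w_{i+1,1}$ for all $i\in\{1,\dots,k\}$, with $i+1$ taken modulo $k$. **Proposition.** For every $k\ge 1$, $$\gamma_t^i(G_k)=3k,\qquad \Gamma_t(G_k)=2k,\qquad \mathrm{OOIR}(G_k)=2k.$$ Consequently, for every $m\ge 0$ there is a $k\ge 1$ such that $G_k$ is connected, $\gamma_t^i(G_k)\ge \Gamma_t(G_k)+m$ and $\gamma_t^i(G_k)\ge \mathrm{OOIR}(G_k)+m$. -/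

import Mathlib

namespace IndicatedTotalDomination

/-- The join of two graphs: their disjoint union together with all edges between the two parts. -/
def graphJoin {V W : Type*} (G : SimpleGraph V) (H : SimpleGraph W) : SimpleGraph (V ⊕ W) :=
  (G ⊕g H) ⊔ completeBipartiteGraph V W

section Invariants

variable {V : Type*}

/-- `v` is totally dominated by the set `D`: it has a neighbor in `D`. -/
def TotallyDominated (G : SimpleGraph V) (D : Finset V) (v : V) : Prop :=
  ∃ u ∈ D, G.Adj u v

/-- `D` is a total dominating set (TD-set): every vertex has a neighbor in `D`. -/
def IsTotalDominatingSet (G : SimpleGraph V) (D : Finset V) : Prop :=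
  ∀ v, TotallyDominated G D v

/-- The upper total domination number: the maximum cardinality of an (inclusion-)minimal
TD-set. -/
noncomputable def upperTotalDominationNumber (G : SimpleGraph V) : ℕ :=
  sSup {n | ∃ S : Finset V, Minimal (IsTotalDominatingSet G) S ∧ S.card = n}

/-- `S` is open-open irredundant: for every `v ∈ S`, the set `N(v) \ N(S \ {v})` is nonempty. -/
def IsOpenOpenIrredundant (G : SimpleGraph V) (S : Finset V) : Prop :=
  ∀ v ∈ S, (G.neighborSet v \ ⋃ u ∈ (S : Set V) \ {v}, G.neighborSet u).Nonempty

/-- The open-open irredundance number: the maximum cardinality of an open-open irredundant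
set. -/
noncomputable def openOpenIrredundanceNumber (G : SimpleGraph V) : ℕ :=
  sSup {n | ∃ S : Finset V, IsOpenOpenIrredundant G S ∧ S.card = n}

/-- `DominatorForces G n D`: in the indicated total domination game on `G`, from the position in
which `D` is the set of vertices selected so far and Dominator is to move, Dominator has a strategy
that guarantees, against every play of Staller, that the game ends with a set of at most `n`
vertices.

* The game is over exactly when the selected set is a TD-set.
* Otherwise Dominator indicates a vertex `v` that is not totally dominated yet, and Staller
  adds to `D` any neighbor `u` of `v` that has not been played yet.

The game is only considered on graphs without isolated vertices. -/
inductive DominatorForces [DecidableEq V] (G : SimpleGraph V) (n : ℕ) : Finset V → Prop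
  | finished (D : Finset V) (hD : IsTotalDominatingSet G D) (hn : D.card ≤ n) :
      DominatorForces G n D
  | indicate (D : Finset V) (v : V) (hv : ¬ TotallyDominated G D v)
      (h : ∀ u, G.Adj v u → u ∉ D → DominatorForces G n (insert u D)) :
      DominatorForces G n D

/-- The indicated total domination number: the size of the final set under optimal play, that is,
the least `n` such that Dominator can force the game, started with no vertex selected, to end with
at most `n` selected vertices. -/
noncomputable def indicatedTotalDominationNumber [DecidableEq V] (G : SimpleGraph V) : ℕ :=
  sInf {n | DominatorForces G n ∅}

end Invariants

/-- The graph `H = P₄ ⊕ P₄` (join). The vertices `u₁, v₁, w₁, x₁` of the first path are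
`Sum.inl 0, …, Sum.inl 3`, and `u₂, v₂, w₂, x₂` of the second path are `Sum.inr 0, …, Sum.inr 3`. -/
def graphH : SimpleGraph (Fin 4 ⊕ Fin 4) :=
  graphJoin (SimpleGraph.pathGraph 4) (SimpleGraph.pathGraph 4)

/-- The disjoint union of `k` copies of `H`. -/
def copiesOfH (k : ℕ) : SimpleGraph (Fin k × (Fin 4 ⊕ Fin 4)) where
  Adj a b := a.1 = b.1 ∧ graphH.Adj a.2 b.2
  symm := ⟨fun _ _ h => ⟨h.1.symm, h.2.symm⟩⟩
  loopless := ⟨fun a h => graphH.loopless.irrefl a.2 h.2⟩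

/-- The linking edges `w_{i,2} w_{i+1,1}`, with `i + 1` taken modulo `k`; they are present only for
`k ≥ 2`. -/
def linkingEdges (k : ℕ) : SimpleGraph (Fin k × (Fin 4 ⊕ Fin 4)) :=
  SimpleGraph.fromRel fun a b =>
    2 ≤ k ∧ (a.1.val + 1) % k = b.1.val ∧ a.2 = Sum.inr 2 ∧ b.2 = Sum.inl 2

/-- The graph `G_k`. -/
def graphG (k : ℕ) : SimpleGraph (Fin k × (Fin 4 ⊕ Fin 4)) :=
  copiesOfH k ⊔ linkingEdges k

end IndicatedTotalDomination

namespace IndicatedTotalDomination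

/-! ### Minimal TD-sets and irredundance -/

section General

variable {V : Type*} {G : SimpleGraph V} {S : Finset V}

/-! Linking edges touch only the vertices `w`, so every other (inner) vertex has all its neighbours
in its own copy of `H`. Each value is thus `k` times a local constant found by finite checks on `H`.
Irredundant sets meet a copy at most twice (`adjH_irredundant_triple`); minimal TD-sets are
irredundant, and `middleSet` attains both bounds. In the game, Staller always replies in the copy of
the indicated vertex and leaves an inner vertex there undominated until that copy holds three
selected vertices. Dominator indicates only inner vertices, which confines the replies to that copy,
and finishes it within three rounds. -/

theorem isOpenOpenIrredundant_iff : IsOpenOpenIrredundant G S ↔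
    ∀ v ∈ S, ∃ p, G.Adj v p ∧ ∀ u ∈ S, u ≠ v → ¬ G.Adj u p := by
  simp only [IsOpenOpenIrredundant, Set.Nonempty, Set.mem_sdiff, SimpleGraph.mem_neighborSet,
    Set.mem_iUnion, Finset.mem_coe, Set.mem_singleton_iff, not_exists, and_imp]

theorem isOpenOpenIrredundant_of_minimal [DecidableEq V]
    (h : Minimal (IsTotalDominatingSet G) S) : IsOpenOpenIrredundant G S := by
  rw [isOpenOpenIrredundant_iff]
  intro v hv
  by_contra! hp
  have hT : IsTotalDominatingSet G (S.erase v) := by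
    intro p
    obtain ⟨u, hu, hup⟩ := h.prop p
    rcases eq_or_ne u v with rfl | huv
    · obtain ⟨w, hw, hne, hadj⟩ := hp p hup
      exact ⟨w, Finset.mem_erase.2 ⟨hne, hw⟩, hadj⟩
    · exact ⟨u, Finset.mem_erase.2 ⟨huv, hu⟩, hup⟩
  exact Finset.notMem_erase v S (h.le_of_le hT (Finset.erase_subset v S) hv)

theorem minimal_of_isOpenOpenIrredundant (hT : IsTotalDominatingSet G S)
    (h : IsOpenOpenIrredundant G S) : Minimal (IsTotalDominatingSet G) S := by
  rw [isOpenOpenIrredundant_iff] at h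
  refine ⟨hT, fun T hTT hTS v hv => ?_⟩
  obtain ⟨p, -, hp⟩ := h v hv
  obtain ⟨u, hu, hup⟩ := hTT p
  rcases eq_or_ne u v with rfl | huv
  · exact hu
  · exact absurd hup (hp u (hTS hu) huv)

end General

/-! ### Finite checks on one copy of `H` -/

section LocalGraph

/-- Adjacency in `graphH` as a Boolean function. -/
def adjH : Fin 4 ⊕ Fin 4 → Fin 4 ⊕ Fin 4 → Bool
  | .inl a, .inl b => a.val + 1 == b.val || b.val + 1 == a.val
  | .inr a, .inr b => a.val + 1 == b.val || b.val + 1 == a.val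
  | .inl _, .inr _ => true
  | .inr _, .inl _ => true

theorem graphH_adj (a b : Fin 4 ⊕ Fin 4) : graphH.Adj a b ↔ adjH a b := by
  rcases a with a | a <;> rcases b with b | b <;>
    simp [graphH, graphJoin, adjH, SimpleGraph.pathGraph_adj]

theorem adjH_comm (a b : Fin 4 ⊕ Fin 4) : adjH a b = adjH b a := by
  revert a b; decide

/-- The vertices of `graphH` that are not incident with linking edges. -/
def IsInner (a : Fin 4 ⊕ Fin 4) : Prop := a ≠ .inl 2 ∧ a ≠ .inr 2

instance : DecidablePred IsInner := fun _ => inferInstanceAs (Decidable (_ ∧ _))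

/-- The positions with fewer than three selected vertices that Staller allows in a copy of `H`. -/
def stallerPositions : Finset (Finset (Fin 4 ⊕ Fin 4)) :=
  {∅, {.inl 0}, {.inr 0}, {.inl 1, .inl 0}, {.inl 2, .inl 0}, {.inr 1, .inr 0}, {.inr 2, .inr 0}}

theorem exists_inner_undominated : ∀ S ∈ stallerPositions,
    ∃ v, IsInner v ∧ ∀ u ∈ S, ¬ adjH u v := by
  decide +kernel

/-- Staller opens with an end of the path not containing `v`. Only vertices of the opened path can
then be undominated, and Staller stays on it for the second move. -/
theorem exists_staller_reply : ∀ S ∈ stallerPositions, ∀ v, (∀ u ∈ S, ¬ adjH u v) →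
    ∃ u, adjH v u ∧ (3 ≤ (insert u S).card ∨ insert u S ∈ stallerPositions) := by
  decide +kernel

theorem exists_adjH (v : Fin 4 ⊕ Fin 4) : ∃ u, adjH v u := by
  revert v; decide

-- Two vertices on different paths dominate all of `H`, and three on one path already clash inside
-- it. Vertices `w` are exempt, as their private neighbour may lie in another copy.
set_option synthInstance.maxHeartbeats 200000 in
set_option synthInstance.maxSize 1000 in
theorem adjH_irredundant_triple : ∀ a b c : Fin 4 ⊕ Fin 4, a ≠ b → a ≠ c → b ≠ c →
    ¬ ((IsInner a → ∃ p, adjH a p ∧ ¬ adjH b p ∧ ¬ adjH c p) ∧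
       (IsInner b → ∃ p, adjH b p ∧ ¬ adjH a p ∧ ¬ adjH c p) ∧
       (IsInner c → ∃ p, adjH c p ∧ ¬ adjH a p ∧ ¬ adjH b p)) := by
  decide +kernel

/-- From the selected set `S` in a copy of `H`, Dominator can have all vertices of the copy
dominated from within after at most `r` further rounds, indicating only inner vertices. -/
def LocallyForces : ℕ → Finset (Fin 4 ⊕ Fin 4) → Prop
  | 0, S => ∀ v, ∃ u ∈ S, adjH u v
  | r + 1, S => (∀ v, ∃ u ∈ S, adjH u v) ∨
      ∃ v, IsInner v ∧ (∀ u ∈ S, ¬ adjH u v) ∧ ∀ u, adjH v u → LocallyForces r (insert u S)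

instance decidableLocallyForces : ∀ r S, Decidable (LocallyForces r S)
  | 0, S => inferInstanceAs (Decidable (∀ v, ∃ u ∈ S, adjH u v))
  | r + 1, S =>
    have := decidableLocallyForces r
    inferInstanceAs (Decidable ((∀ v, ∃ u ∈ S, adjH u v) ∨
      ∃ v, IsInner v ∧ (∀ u ∈ S, ¬ adjH u v) ∧ ∀ u, adjH v u → LocallyForces r (insert u S)))

/-- Dominator can indicate path ends: a reply on the same path is the middle vertex next to that
end. Both middle vertices of a path, or one vertex on each path, dominate `H`. -/
theorem locallyForces_empty : LocallyForces 3 ∅ := by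
  decide +kernel

end LocalGraph

/-! ### From one copy to `G_k` -/

section GlobalGraph

variable {k : ℕ}

theorem graphG_adj_of_adjH (i : Fin k) {a b : Fin 4 ⊕ Fin 4} (h : adjH a b) :
    (graphG k).Adj (i, a) (i, b) :=
  Or.inl ⟨rfl, (graphH_adj a b).2 h⟩

theorem graphG_adj_of_isInner {i j : Fin k} {a b : Fin 4 ⊕ Fin 4} (ha : IsInner a)
    (h : (graphG k).Adj (i, a) (j, b)) : j = i ∧ adjH a b := by
  rcases h with ⟨h1, h2⟩ | ⟨-, h | h⟩
  · exact ⟨h1.symm, (graphH_adj a b).1 h2⟩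
  · exact absurd h.2.2.1 ha.2
  · exact absurd h.2.2.2 ha.1

/-- The part of `D` that lies in the `i`-th copy of `H`. -/
def slice (D : Finset (Fin k × (Fin 4 ⊕ Fin 4))) (i : Fin k) : Finset (Fin 4 ⊕ Fin 4) :=
  {a | (i, a) ∈ D}

@[simp]
theorem mem_slice {D : Finset (Fin k × (Fin 4 ⊕ Fin 4))} {i : Fin k} {a : Fin 4 ⊕ Fin 4} :
    a ∈ slice D i ↔ (i, a) ∈ D := by
  simp [slice]

@[simp]
theorem slice_empty (i : Fin k) : slice ∅ i = ∅ := by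
  ext; simp

theorem slice_insert_self (D : Finset (Fin k × (Fin 4 ⊕ Fin 4))) (i : Fin k)
    (a : Fin 4 ⊕ Fin 4) : slice (insert (i, a) D) i = insert a (slice D i) := by
  ext; simp

theorem slice_insert_of_ne (D : Finset (Fin k × (Fin 4 ⊕ Fin 4))) {i j : Fin k}
    (a : Fin 4 ⊕ Fin 4) (h : j ≠ i) : slice (insert (i, a) D) j = slice D j := by
  ext; simp [h]

theorem card_eq_sum_slice (D : Finset (Fin k × (Fin 4 ⊕ Fin 4))) :
    D.card = ∑ i, (slice D i).card := by
  rw [Finset.card_eq_sum_card_fiberwise (f := Prod.fst) (t := Finset.univ) (by simp)]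
  refine Finset.sum_congr rfl fun i _ => ?_
  rw [← Finset.card_image_of_injective (slice D i) (Prod.mk_right_injective i)]
  congr 1
  ext ⟨j, a⟩
  simp only [Finset.mem_filter, Finset.mem_image, mem_slice, Prod.mk.injEq]
  constructor
  · rintro ⟨h, rfl⟩; exact ⟨a, h, rfl, rfl⟩
  · rintro ⟨b, h, rfl, rfl⟩; exact ⟨h, rfl⟩

theorem card_slice_le_two {S : Finset (Fin k × (Fin 4 ⊕ Fin 4))}
    (hS : IsOpenOpenIrredundant (graphG k) S) (i : Fin k) : (slice S i).card ≤ 2 := by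
  rw [isOpenOpenIrredundant_iff] at hS
  have key : ∀ a ∈ slice S i, IsInner a →
      ∃ p, adjH a p ∧ ∀ u ∈ slice S i, u ≠ a → ¬ adjH u p := by
    intro a ha hin
    obtain ⟨⟨j, p⟩, hp, hpriv⟩ := hS (i, a) (mem_slice.1 ha)
    obtain ⟨rfl, hap⟩ := graphG_adj_of_isInner hin hp
    exact ⟨p, hap, fun u hu hua h => hpriv (j, u) (mem_slice.1 hu) (by simpa using hua)
      (graphG_adj_of_adjH j h)⟩
  by_contra! hc
  obtain ⟨a, b, c, ha, hb, hc, hab, hac, hbc⟩ := Finset.two_lt_card_iff.1 hc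
  refine adjH_irredundant_triple a b c hab hac hbc ⟨fun h => ?_, fun h => ?_, fun h => ?_⟩
  · obtain ⟨p, hp, hq⟩ := key a ha h
    exact ⟨p, hp, hq b hb hab.symm, hq c hc hac.symm⟩
  · obtain ⟨p, hp, hq⟩ := key b hb h
    exact ⟨p, hp, hq a ha hab, hq c hc hbc.symm⟩
  · obtain ⟨p, hp, hq⟩ := key c hc h
    exact ⟨p, hp, hq a ha hac, hq b hb hbc⟩

theorem card_le_of_isOpenOpenIrredundant {S : Finset (Fin k × (Fin 4 ⊕ Fin 4))}
    (hS : IsOpenOpenIrredundant (graphG k) S) : S.card ≤ 2 * k := by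
  rw [card_eq_sum_slice]
  calc ∑ i, (slice S i).card ≤ ∑ _i : Fin k, 2 :=
        Finset.sum_le_sum fun i _ => card_slice_le_two hS i
    _ = 2 * k := by simp [mul_comm]

variable (k) in
/-- The set of all vertices `v_{i,1}` and `w_{i,1}`. -/
def middleSet : Finset (Fin k × (Fin 4 ⊕ Fin 4)) :=
  Finset.univ ×ˢ {.inl 1, .inl 2}

theorem card_middleSet : (middleSet k).card = 2 * k := by
  simp [middleSet, Finset.card_product, mul_comm]

theorem isTotalDominatingSet_middleSet : IsTotalDominatingSet (graphG k) (middleSet k) := by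
  rintro ⟨i, v⟩
  have h : ∀ v, ∃ u ∈ ({.inl 1, .inl 2} : Finset (Fin 4 ⊕ Fin 4)), adjH u v := by decide
  obtain ⟨u, hu, huv⟩ := h v
  exact ⟨(i, u), Finset.mem_product.2 ⟨Finset.mem_univ _, hu⟩, graphG_adj_of_adjH i huv⟩

theorem isOpenOpenIrredundant_middleSet : IsOpenOpenIrredundant (graphG k) (middleSet k) := by
  rw [isOpenOpenIrredundant_iff]
  rintro ⟨i, v⟩ hv
  -- The private neighbours are the path ends `.inl 0` and `.inl 3`; being inner, they are out of
  -- reach of other copies.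
  have h : ∀ v ∈ ({.inl 1, .inl 2} : Finset (Fin 4 ⊕ Fin 4)), ∃ p, IsInner p ∧ adjH v p ∧
      ∀ u ∈ ({.inl 1, .inl 2} : Finset (Fin 4 ⊕ Fin 4)), u ≠ v → ¬ adjH p u := by decide
  obtain ⟨p, hin, hvp, hp⟩ := h v (Finset.mem_product.1 hv).2
  refine ⟨(i, p), graphG_adj_of_adjH i hvp, ?_⟩
  rintro ⟨j, u⟩ hu hne hadj
  obtain ⟨rfl, hpu⟩ := graphG_adj_of_isInner hin hadj.symm
  exact hp u (Finset.mem_product.1 hu).2 (by simpa using hne) hpu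

theorem openOpenIrredundanceNumber_graphG (k : ℕ) :
    openOpenIrredundanceNumber (graphG k) = 2 * k := by
  refine IsGreatest.csSup_eq ⟨⟨_, isOpenOpenIrredundant_middleSet, card_middleSet⟩, ?_⟩
  rintro _ ⟨S, hS, rfl⟩
  exact card_le_of_isOpenOpenIrredundant hS

theorem upperTotalDominationNumber_graphG (k : ℕ) :
    upperTotalDominationNumber (graphG k) = 2 * k := by
  refine IsGreatest.csSup_eq ⟨⟨_, minimal_of_isOpenOpenIrredundant
    isTotalDominatingSet_middleSet isOpenOpenIrredundant_middleSet, card_middleSet⟩, ?_⟩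
  rintro _ ⟨S, hS, rfl⟩
  exact card_le_of_isOpenOpenIrredundant (isOpenOpenIrredundant_of_minimal hS)

/-- Staller can keep the selected part of every copy of `H` among `stallerPositions` until it has
at least three vertices. -/
theorem le_of_dominatorForces {n : ℕ} {D : Finset (Fin k × (Fin 4 ⊕ Fin 4))}
    (h : DominatorForces (graphG k) n D)
    (hD : ∀ i, 3 ≤ (slice D i).card ∨ slice D i ∈ stallerPositions) : 3 * k ≤ n := by
  induction h with
  | finished D hT hn =>
    have h3 : ∀ i, 3 ≤ (slice D i).card := by
      intro i
      refine (hD i).resolve_right fun hi => ?_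
      obtain ⟨v, hin, hv⟩ := exists_inner_undominated _ hi
      obtain ⟨⟨j, u⟩, hu, huv⟩ := hT (i, v)
      obtain ⟨rfl, h⟩ := graphG_adj_of_isInner hin huv.symm
      exact hv u (mem_slice.2 hu) (adjH_comm v u ▸ h)
    calc 3 * k = ∑ _i : Fin k, 3 := by simp [mul_comm]
      _ ≤ ∑ i, (slice D i).card := Finset.sum_le_sum fun i _ => h3 i
      _ = D.card := (card_eq_sum_slice D).symm
      _ ≤ n := hn
  | indicate D v hv _ ih =>
    obtain ⟨i, v⟩ := v
    have hund : ∀ u, adjH v u → (i, u) ∉ D := fun u hvu hu =>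
      hv ⟨_, hu, (graphG_adj_of_adjH i hvu).symm⟩
    obtain ⟨u, hvu, hu⟩ : ∃ u, adjH v u ∧
        (3 ≤ (insert u (slice D i)).card ∨ insert u (slice D i) ∈ stallerPositions) := by
      rcases hD i with h | h
      · obtain ⟨u, hu⟩ := exists_adjH v
        exact ⟨u, hu, Or.inl (h.trans (Finset.card_le_card (Finset.subset_insert _ _)))⟩
      · exact exists_staller_reply _ h v fun u hu huv =>
          hund u (adjH_comm u v ▸ huv) (mem_slice.1 hu)
    refine ih (i, u) (graphG_adj_of_adjH i hvu) (hund u hvu) fun j => ?_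
    rcases eq_or_ne j i with rfl | hj
    · rwa [slice_insert_self]
    · rw [slice_insert_of_ne D u hj]; exact hD j

/-- Dominator can play local strategies on the copies of `H` one after the other. -/
theorem dominatorForces_of_locallyForces (n : ℕ) (r : Fin k → ℕ)
    (D : Finset (Fin k × (Fin 4 ⊕ Fin 4))) (hD : ∀ i, LocallyForces (r i) (slice D i))
    (hn : D.card + ∑ i, r i ≤ n) : DominatorForces (graphG k) n D := by
  induction hs : ∑ i, r i generalizing r D with
  | zero =>
    refine .finished D ?_ (by omega)
    rintro ⟨i, v⟩
    have h0 := hD i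
    rw [Finset.sum_eq_zero_iff.1 hs i (Finset.mem_univ i)] at h0
    obtain ⟨u, hu, huv⟩ := h0 v
    exact ⟨(i, u), mem_slice.1 hu, graphG_adj_of_adjH i huv⟩
  | succ s ih =>
    obtain ⟨i, hi⟩ : ∃ i, r i ≠ 0 := by
      by_contra! h
      simp [h] at hs
    obtain ⟨t, ht⟩ := Nat.exists_eq_succ_of_ne_zero hi
    have hsum : ∑ j, Function.update r i t j = s := by
      have h1 := Finset.add_sum_erase Finset.univ r (Finset.mem_univ i)
      have h2 := Finset.sum_update_of_mem (Finset.mem_univ i) r t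
      rw [← Finset.erase_eq] at h2
      omega
    have hL := hD i
    rw [ht] at hL
    rcases hL with hdom | ⟨v, hin, hv, hrep⟩
    -- The copy is already dominated, so one unit of its budget is dropped without a move.
    · refine ih (Function.update r i t) D (fun j => ?_) (by omega) hsum
      rcases eq_or_ne j i with rfl | hj
      · rw [Function.update_self]
        cases t with
        | zero => exact hdom
        | succ t => exact Or.inl hdom
      · rw [Function.update_of_ne hj]; exact hD j
    · refine .indicate D (i, v) ?_ ?_
      · rintro ⟨⟨j, u⟩, hu, huv⟩
        obtain ⟨rfl, h⟩ := graphG_adj_of_isInner hin huv.symm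
        exact hv u (mem_slice.2 hu) (adjH_comm v u ▸ h)
      · rintro ⟨j, u⟩ hvu hu
        obtain ⟨rfl, h⟩ := graphG_adj_of_isInner hin hvu
        refine ih (Function.update r j t) _ (fun l => ?_) ?_ hsum
        · rcases eq_or_ne l j with rfl | hl
          · rw [Function.update_self, slice_insert_self]
            exact hrep u h
          · rw [Function.update_of_ne hl, slice_insert_of_ne D u hl]; exact hD l
        · rw [Finset.card_insert_of_notMem hu]
          omega

theorem indicatedTotalDominationNumber_graphG (k : ℕ) :
    indicatedTotalDominationNumber (graphG k) = 3 * k := by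
  refine IsLeast.csInf_eq ⟨?_, fun n hn => le_of_dominatorForces hn fun i => ?_⟩
  · refine dominatorForces_of_locallyForces _ (fun _ => 3) ∅ (fun i => ?_) (by simp [mul_comm])
    rw [slice_empty]
    exact locallyForces_empty
  · rw [slice_empty]
    exact Or.inr (by simp [stallerPositions])

theorem graphG_connected (hk : 1 ≤ k) : (graphG k).Connected := by
  have hcopy : ∀ (i : Fin k) (a b), (graphG k).Reachable (i, a) (i, b) := by
    intro i a b
    -- Any two vertices of `H` have a common neighbour.
    have h : ∀ a b, ∃ c, adjH a c ∧ adjH c b := by decide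
    obtain ⟨c, hac, hcb⟩ := h a b
    exact (graphG_adj_of_adjH i hac).reachable.trans (graphG_adj_of_adjH i hcb).reachable
  have hbase : ∀ (n : ℕ) (hn : n < k) (a), (graphG k).Reachable (⟨0, hk⟩, .inl 2) (⟨n, hn⟩, a) := by
    intro n
    induction n with
    | zero => exact fun _ a => hcopy _ _ _
    | succ n ih =>
      intro hn a
      have hlink : (graphG k).Adj (⟨n, by omega⟩, .inr 2) (⟨n + 1, hn⟩, .inl 2) :=
        Or.inr ⟨by simp, Or.inl ⟨by omega, Nat.mod_eq_of_lt hn, rfl, rfl⟩⟩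
      exact ((ih (by omega) _).trans hlink.reachable).trans (hcopy _ _ _)
  exact SimpleGraph.connected_iff_exists_forall_reachable _ |>.2
    ⟨(⟨0, hk⟩, .inl 2), fun ⟨i, a⟩ => hbase i.1 i.2 a⟩

end GlobalGraph

end IndicatedTotalDomination

theorem mainTheorem5 :
    (∀ k : ℕ, 1 ≤ k →
      IndicatedTotalDomination.indicatedTotalDominationNumber
          (IndicatedTotalDomination.graphG k) = 3 * k ∧
      IndicatedTotalDomination.upperTotalDominationNumber
          (IndicatedTotalDomination.graphG k) = 2 * k ∧
      IndicatedTotalDomination.openOpenIrredundanceNumber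
          (IndicatedTotalDomination.graphG k) = 2 * k) ∧
    (∀ m : ℕ, ∃ k : ℕ, 1 ≤ k ∧ (IndicatedTotalDomination.graphG k).Connected ∧
      IndicatedTotalDomination.upperTotalDominationNumber
          (IndicatedTotalDomination.graphG k) + m ≤
        IndicatedTotalDomination.indicatedTotalDominationNumber
          (IndicatedTotalDomination.graphG k) ∧
      IndicatedTotalDomination.openOpenIrredundanceNumber
          (IndicatedTotalDomination.graphG k) + m ≤
        IndicatedTotalDomination.indicatedTotalDominationNumber
          (IndicatedTotalDomination.graphG k)) := by
  refine ⟨fun k _ => ⟨IndicatedTotalDomination.indicatedTotalDominationNumber_graphG k,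
    IndicatedTotalDomination.upperTotalDominationNumber_graphG k,
    IndicatedTotalDomination.openOpenIrredundanceNumber_graphG k⟩, fun m => ⟨m + 1, by omega,
    IndicatedTotalDomination.graphG_connected (by omega), ?_, ?_⟩⟩
  · rw [IndicatedTotalDomination.indicatedTotalDominationNumber_graphG,
      IndicatedTotalDomination.upperTotalDominationNumber_graphG]
    omega
  · rw [IndicatedTotalDomination.indicatedTotalDominationNumber_graphG,
      IndicatedTotalDomination.openOpenIrredundanceNumber_graphG]
    omega
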